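/- Let $\mathbb K$ be a field and let $m\ge 2$, $r\ge 2$, $1\le s\le r$ be integers. Let $n_1\le n_2\le\dots\le n_r$ be positive integers with $n_k=1$ for $k<s$ and $n_k\ge 2$ for $k\ge s$, and put $n=\sum_{k=1}^r n_k$. Let $G$ be a complete $r$-partite graph on the vertex set $[n]=\{1,\dots,n\}$ with parts $V_1,\dots,V_r$, where $|V_k|=n_k$ (so two vertices are adjacent if and only if they lie in different parts). Let $S=\mathbb K[x_{ij}: 1\le i\le m,\ 1\le j\le n]$ with the standard grading, and let $$\mathcal J_{K_m,G}=\bigl(x_{ik}x_{jl}-x_{il}x_{jk} : 1\le i<j\le m,\ \{k,l\}\in E(G),\ k<l\bigr)\subset S$$ be the generalized binomial edge ideal of $G$. Then the Hilbert series $\operatorname{Hilb}(S/\mathcal J_{K_m,G})=\sum_{d\ge 0}\dim_{\mathbb K}(S/\mathcal J_{K_m,G})_d\,t^d$ is $$\operatorname{Hilb}(S/\mathcal J_{K_m,G})=\frac{\sum_{i\ge 0}\binom{m-1}{i}\binom{n-1}{i}t^i}{(1-t)^{m+n-1}}+\sum_{k=s}^{r}\left(\frac{1}{(1-t)^{mn_k}}-\frac{\sum_{i\ge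 0}\binom{m-1}{i}\binom{n_k-1}{i}t^i}{(1-t)^{m+n_k-1}}\right),$$ where the rational functions are expanded as power series in $t$. -/

import Mathlib

open scoped PowerSeries

/-- The binomial edge ideal of a pair of simple graphs `G₁` on `[m]` and `G₂` on `[n]`: the ideal of
`K[x_{ij} : i ∈ [m], j ∈ [n]]` generated by the 2-minors `x_{ik} x_{jl} - x_{il} x_{jk}` for the
edges `{i, j}` of `G₁` with `i < j` and the edges `{k, l}` of `G₂` with `k < l`. -/
noncomputable def binomialEdgeIdealPair (K : Type*) [Field K] {m n : ℕ}
    (G₁ : SimpleGraph (Fin m)) (G₂ : SimpleGraph (Fin n)) :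
    Ideal (MvPolynomial (Fin m × Fin n) K) :=
  Ideal.span {p | ∃ i j k l, G₁.Adj i j ∧ i < j ∧ G₂.Adj k l ∧ k < l ∧
    p = MvPolynomial.X (i, k) * MvPolynomial.X (j, l)
      - MvPolynomial.X (i, l) * MvPolynomial.X (j, k)}

/-- The generalized binomial edge ideal of `G`: the binomial edge ideal of the pair `(K_m, G)`. -/
noncomputable def generalizedBinomialEdgeIdeal (K : Type*) [Field K] (m : ℕ) {n : ℕ}
    (G : SimpleGraph (Fin n)) : Ideal (MvPolynomial (Fin m × Fin n) K) :=
  binomialEdgeIdealPair K (⊤ : SimpleGraph (Fin m)) G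

/-- `G` is complete multipartite with the (pairwise disjoint) parts `V k`: the parts cover the vertex
set, and two vertices are adjacent exactly when they lie in different parts. -/
structure IsCompletePartite {W ι : Type*} (G : SimpleGraph W) (V : ι → Finset W) : Prop where
  disjoint : Pairwise fun i j => Disjoint (V i) (V j)
  cover : ∀ w, ∃ i, w ∈ V i
  adj_iff : ∀ u v, G.Adj u v ↔ ∃ i j, i ≠ j ∧ u ∈ V i ∧ v ∈ V j

/-- The degree `d` component of `S / I`, for `S` a polynomial ring with its standard grading and `I`
a homogeneous ideal: the image of the space of forms of degree `d`. -/
noncomputable def quotientComponent {K σ : Type*} [Field K] (I : Ideal (MvPolynomial σ K)) (d : ℕ) :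
    Submodule K (MvPolynomial σ K ⧸ I) :=
  (MvPolynomial.homogeneousSubmodule σ K d).map (Ideal.Quotient.mkₐ K I).toLinearMap

/-- The Hilbert series `∑_d dim_K (S / I)_d t^d` of the standard graded algebra `S / I`, where `S` is a
polynomial ring in finitely many variables and `I` is a homogeneous ideal. -/
noncomputable def hilbertSeries {K σ : Type*} [Field K] [Finite σ] (I : Ideal (MvPolynomial σ K)) :
    ℤ⟦X⟧ :=
  PowerSeries.mk fun d => (Module.finrank K (quotientComponent I d) : ℤ)

/-- The components of `S / I` are finite-dimensional, so `Module.finrank` is their dimension. -/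
theorem quotientComponent_finite {K σ : Type*} [Field K] [Finite σ] (I : Ideal (MvPolynomial σ K))
    (d : ℕ) : Module.Finite K (quotientComponent I d) := by
  have h : Module.Finite K (MvPolynomial.homogeneousSubmodule σ K d) := by
    have hle : MvPolynomial.homogeneousSubmodule σ K d ≤
        MvPolynomial.restrictTotalDegree σ K d := by
      intro p hp
      rw [MvPolynomial.mem_restrictTotalDegree]
      exact MvPolynomial.IsHomogeneous.totalDegree_le hp
    have : Module.Finite K (MvPolynomial.restrictTotalDegree σ K d) := inferInstance
    exact Submodule.finiteDimensional_of_le hle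
  exact Module.Finite.map _ _

/-- Binomial edge ideals are homogeneous, so their quotient rings are graded. -/
theorem binomialEdgeIdealPair_isHomogeneous (K : Type*) [Field K] {m n : ℕ}
    (G₁ : SimpleGraph (Fin m)) (G₂ : SimpleGraph (Fin n)) :
    letI : GradedAlgebra (MvPolynomial.homogeneousSubmodule (Fin m × Fin n) K) :=
      MvPolynomial.gradedAlgebra
    (binomialEdgeIdealPair K G₁ G₂).IsHomogeneous
      (MvPolynomial.homogeneousSubmodule (Fin m × Fin n) K) := by
  let _ : GradedAlgebra (MvPolynomial.homogeneousSubmodule (Fin m × Fin n) K) :=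
    MvPolynomial.gradedAlgebra
  apply Ideal.homogeneous_span
  rintro p ⟨i, j, k, l, -, -, -, -, rfl⟩
  exact ⟨2, Submodule.sub_mem _
    ((MvPolynomial.isHomogeneous_X K (i, k)).mul (MvPolynomial.isHomogeneous_X K (j, l)))
    ((MvPolynomial.isHomogeneous_X K (i, l)).mul (MvPolynomial.isHomogeneous_X K (j, k)))⟩

/-- The rational function `(∑_{i ≥ 0} C(p - 1, i) C(q - 1, i) t^i) / (1 - t)^(p + q - 1)`, for
`p, q ≥ 1`, expanded as a power series. The terms with `i ≥ p` vanish. -/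
noncomputable def minorSeries (p q : ℕ) : ℤ⟦X⟧ :=
  (∑ i ∈ Finset.range p, (((p - 1).choose i * (q - 1).choose i : ℕ) : ℤ⟦X⟧) * PowerSeries.X ^ i) *
    (PowerSeries.invOneSubPow ℤ (p + q - 1) : ℤ⟦X⟧)

/-!
Let `J` be the generalized binomial edge ideal of a complete multipartite graph with parts `V k`.
It is generated by differences of monomials, so the classes modulo `J` of the distinct monomials
form a basis of `S / J`, and `dim (S / J)_d` is the number of congruence classes of monomials of
degree `d` (`ker_monomialClassMap`, `finrank_map_monomialClassMap`).

A monomial is an exponent matrix, and the generators preserve its row sums and its column sums. If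
the columns in use lie in one part, no generator can be applied, and the monomial is alone in its
class. Otherwise its class consists of all monomials with the same row and column sums
(`monomial_sub_monomial_mem`): write the monomial as a word of variables `x_{ρ(t), c(t)}` and fix the
column word `c`. Modulo `J`, two entries of the row word `ρ` may be exchanged when their columns are
adjacent. The positions with adjacency of columns form a connected graph, since a transposition of
two positions in the same part can be routed through a position in another part; so these exchanges
generate all permutations of the row word (`prod_X_perm_sub_mem`).

It remains to count the invariants. A pair of row and column sums of total degree `d` whose columns
are not contained in one part counts once, and every monomial of degree `d` supported on the columns
of a single part counts once (`card_image_partiteClass`). The numbers of pairs and of monomials are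
the coefficients of `minorSeries` and of `1 / (1 - t) ^ (m * N k)`; for `minorSeries` this is the
identity `∑ i, C(P, i) C(Q, i) C(P + Q + d - i, P + Q) = C(P + d, P) C(Q + d, Q)`.
-/

/-! ### Coefficients of the power series -/

/-- Induction on `Q`: both sides satisfy `(Q + 1) a (Q + 1) = (d + Q + 1) a Q`. For the sum this
follows by rewriting each summand and shifting the index in one half of the result. -/
theorem sum_antidiagonal_choose_mul_choose_mul_choose (P Q d : ℕ) :
    ∑ x ∈ Finset.HasAntidiagonal.antidiagonal d,
        P.choose x.1 * Q.choose x.1 * (P + Q + x.2).choose (P + Q) =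
      (P + d).choose P * (Q + d).choose Q := by
  induction Q with
  | zero =>
    rw [Finset.sum_eq_single_of_mem (0, d) (by simp)]
    · simp
    · rintro ⟨i, j⟩ hx hne
      have hi : i ≠ 0 := by
        rintro rfl
        apply hne
        simpa using hx
      obtain ⟨i, rfl⟩ := Nat.exists_eq_succ_of_ne_zero hi
      simp
  | succ Q ih =>
    have hQ : (Q + 1) * (Q + 1 + d).choose (Q + 1) = (d + Q + 1) * (Q + d).choose Q := by
      have := Nat.add_one_mul_choose_eq (Q + d) Q
      rw [show Q + 1 + d = Q + d + 1 by ring]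
      linarith
    apply Nat.eq_of_mul_eq_mul_left (Nat.succ_pos Q)
    calc (Q + 1) * ∑ x ∈ Finset.HasAntidiagonal.antidiagonal d,
          P.choose x.1 * (Q + 1).choose x.1 * (P + (Q + 1) + x.2).choose (P + (Q + 1))
        = ∑ x ∈ Finset.HasAntidiagonal.antidiagonal d,
            ((Q + 1 + x.1) * P.choose x.1 * Q.choose x.1
              * (P + Q + 1 + x.2).choose (P + Q + 1)) +
          ∑ x ∈ Finset.HasAntidiagonal.antidiagonal d,
            (x.1 * P.choose x.1 * Q.choose (x.1 - 1)
              * (P + Q + 1 + x.2).choose (P + Q + 1)) := by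
          rw [← Finset.sum_add_distrib, Finset.mul_sum]
          refine Finset.sum_congr rfl ?_
          rintro ⟨i, j⟩ -
          have h : (Q + 1) * (Q + 1).choose i =
              (Q + 1 + i) * Q.choose i + i * Q.choose (i - 1) := by
            rcases i with _ | i
            · simp
            · have h1 := Nat.add_one_mul_choose_eq Q i
              have h2 := Nat.choose_succ_succ Q i
              simp only [Nat.succ_eq_add_one, Nat.add_sub_cancel] at *
              nlinarith
          rw [← add_assoc]
          simp only
          linear_combination P.choose i * (P + Q + 1 + j).choose (P + Q + 1) * h
      _ = ∑ x ∈ Finset.HasAntidiagonal.antidiagonal d,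
            ((Q + 1 + x.1) * P.choose x.1 * Q.choose x.1
              * (P + Q + 1 + x.2).choose (P + Q + 1)) +
          ∑ x ∈ Finset.HasAntidiagonal.antidiagonal d,
            ((P - x.1) * P.choose x.1 * Q.choose x.1
              * (P + Q + x.2).choose (P + Q + 1)) := by
          -- shift the index `x.1` by one, using `(i + 1) C(P, i + 1) = (P - i) C(P, i)`
          congr 1
          rcases d with _ | d
          · simp
          · rw [Finset.Nat.sum_antidiagonal_succ, Finset.Nat.sum_antidiagonal_succ']
            simp only [Nat.choose_succ_self, zero_mul, mul_zero, add_zero, zero_add]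
            refine Finset.sum_congr rfl ?_
            rintro ⟨i, j⟩ -
            have := Nat.choose_succ_right_eq P i
            simp only [Nat.add_sub_cancel]
            rw [show P + Q + (j + 1) = P + Q + 1 + j by ring]
            linear_combination Q.choose i * (P + Q + 1 + j).choose (P + Q + 1) * this
      _ = ∑ x ∈ Finset.HasAntidiagonal.antidiagonal d,
            (d + Q + 1) * (P.choose x.1 * Q.choose x.1 * (P + Q + x.2).choose (P + Q)) := by
          rw [← Finset.sum_add_distrib]
          refine Finset.sum_congr rfl ?_
          rintro ⟨i, j⟩ hx
          have hx : i + j = d := by simpa using hx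
          subst hx
          simp only
          rcases lt_or_ge P i with hi | hi
          · simp [Nat.choose_eq_zero_of_lt hi]
          -- for `i ≤ P` the truncated difference `P - i` is the true one
          · obtain ⟨e, rfl⟩ := Nat.exists_eq_add_of_le hi
            have h1 := Nat.choose_succ_succ (i + e + Q + j) (i + e + Q)
            have h2 := Nat.choose_succ_right_eq (i + e + Q + j) (i + e + Q)
            rw [show i + e + Q + j - (i + e + Q) = j by omega] at h2
            rw [show i + e - i = e by omega,
              show i + e + Q + 1 + j = i + e + Q + j + 1 by ring]
            simp only [Nat.succ_eq_add_one] at h1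
            rw [h1]
            linear_combination (i + e).choose i * Q.choose i * h2
      _ = (Q + 1) * ((P + d).choose P * (Q + 1 + d).choose (Q + 1)) := by
          rw [← Finset.mul_sum, ih]
          linear_combination (P + d).choose P * hQ.symm

/-- The coefficient of `t ^ d` is the number of pairs of monomials of degree `d` in `p` and in `q`
variables. -/
theorem coeff_minorSeries {p q : ℕ} (hp : 0 < p) (hq : 0 < q) (d : ℕ) :
    PowerSeries.coeff d (minorSeries p q) =
      ((p + d - 1).choose d : ℤ) * ((q + d - 1).choose d : ℤ) := by
  obtain ⟨P, rfl⟩ := Nat.exists_eq_succ_of_ne_zero hp.ne'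
  obtain ⟨Q, rfl⟩ := Nat.exists_eq_succ_of_ne_zero hq.ne'
  have hsum : (∑ i ∈ Finset.range (P + 1),
      ((P.choose i * Q.choose i : ℕ) : ℤ⟦X⟧) * PowerSeries.X ^ i) =
      PowerSeries.mk fun i => ((P.choose i * Q.choose i : ℕ) : ℤ) := by
    ext e
    rw [map_sum, PowerSeries.coeff_mk]
    have h (i : ℕ) : PowerSeries.coeff e
        (((P.choose i * Q.choose i : ℕ) : ℤ⟦X⟧) * PowerSeries.X ^ i) =
        if e = i then ((P.choose i * Q.choose i : ℕ) : ℤ) else 0 := by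
      rw [← map_natCast (PowerSeries.C (R := ℤ)), PowerSeries.coeff_C_mul, PowerSeries.coeff_X_pow]
      simp
    simp only [h, Finset.sum_ite_eq, Finset.mem_range]
    split_ifs with he
    · rfl
    · rw [Nat.choose_eq_zero_of_lt (by omega)]; simp
  have hmul := sum_antidiagonal_choose_mul_choose_mul_choose P Q d
  unfold minorSeries
  simp only [Nat.succ_eq_add_one, Nat.add_sub_cancel]
  rw [hsum, show P + 1 + (Q + 1) - 1 = P + Q + 1 by omega,
    PowerSeries.invOneSubPow_val_succ_eq_mk_add_choose, PowerSeries.coeff_mul]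
  simp only [PowerSeries.coeff_mk]
  rw [show P + 1 + d - 1 = P + d by omega, show Q + 1 + d - 1 = Q + d by omega,
    ← Nat.choose_symm_add, ← Nat.choose_symm_add]
  exact_mod_cast hmul

theorem coeff_invOneSubPow {p : ℕ} (hp : 0 < p) (d : ℕ) :
    PowerSeries.coeff d (PowerSeries.invOneSubPow ℤ p : ℤ⟦X⟧) = ((p + d - 1).choose d : ℤ) := by
  obtain ⟨P, rfl⟩ := Nat.exists_eq_succ_of_ne_zero hp.ne'
  rw [Nat.succ_eq_add_one, PowerSeries.invOneSubPow_val_succ_eq_mk_add_choose,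
    PowerSeries.coeff_mk, show P + 1 + d - 1 = P + d by omega, Nat.choose_symm_add]

/-! ### Monomials as words -/

section Words

variable {α ι : Type*}

/-- A monomial of degree `d` is a word of `d` variables. -/
theorem exists_sum_single_eq {d : ℕ} (u : α →₀ ℕ) (h : u.degree = d) :
    ∃ f : Fin d → α, ∑ t, Finsupp.single (f t) 1 = u := by
  induction d generalizing u with
  | zero =>
    rw [Finsupp.degree_eq_zero_iff] at h
    exact ⟨Fin.elim0, by simp [h]⟩
  | succ d ih =>
    have hu : u ≠ 0 := by
      rintro rfl
      simp at h
    obtain ⟨i, hi⟩ := Finsupp.ne_iff.mp hu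
    have hle : Finsupp.single i 1 ≤ u := by
      rw [Finsupp.single_le_iff]
      exact Nat.one_le_iff_ne_zero.mpr hi
    have hsum := add_tsub_cancel_of_le hle
    obtain ⟨f, hf⟩ := ih (u - Finsupp.single i 1) (by
      have := congrArg Finsupp.degree hsum
      rw [map_add, Finsupp.degree_single, h] at this
      omega)
    exact ⟨Fin.cons i f, by simp [Fin.sum_univ_succ, hf, hsum]⟩

/-- Two words that spell the same monomial are rearrangements of each other. -/
theorem exists_perm_of_sum_single_eq [Fintype ι] (f g : ι → α)
    (h : ∑ t, Finsupp.single (f t) 1 = ∑ t, Finsupp.single (g t) (1 : ℕ)) :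
    ∃ σ : Equiv.Perm ι, ∀ t, g (σ t) = f t := by
  classical
  have hc (c : α) : Nonempty ({t // f t = c} ≃ {t // g t = c}) := by
    have := DFunLike.congr_fun h c
    simp only [Finsupp.coe_finsetSum, Finset.sum_apply, Finsupp.single_apply, Finset.sum_boole,
      Nat.cast_id] at this
    rw [← Fintype.card_eq, Fintype.card_subtype, Fintype.card_subtype]
    exact this
  exact ⟨Equiv.ofFiberEquiv fun c => (hc c).some, fun t => Equiv.ofFiberEquiv_map _ t⟩

end Words

/-! ### Quotients by ideals of monomial differences -/

section LinearAlgebra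

open MvPolynomial

theorem finrank_map_eq_of_ker_eq {K E F F' : Type*} [Field K] [AddCommGroup E] [Module K E]
    [AddCommGroup F] [Module K F] [AddCommGroup F'] [Module K F'] (f : E →ₗ[K] F) (g : E →ₗ[K] F')
    (h : LinearMap.ker f = LinearMap.ker g) (W : Submodule K E) :
    Module.finrank K (W.map f) = Module.finrank K (W.map g) := by
  have e1 := (f.domRestrict W).quotKerEquivRange
  have e2 := (g.domRestrict W).quotKerEquivRange
  have hk : LinearMap.ker (f.domRestrict W) = LinearMap.ker (g.domRestrict W) := by
    rw [LinearMap.ker_domRestrict, LinearMap.ker_domRestrict, h]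
  rw [← LinearMap.range_domRestrict, ← LinearMap.range_domRestrict, ← e1.finrank_eq,
    ← e2.finrank_eq, hk]

/-- The linear map that sends a monomial to the basis vector of its class under `c`. -/
noncomputable def monomialClassMap (K : Type*) [Field K] {σ ι : Type*} (c : (σ →₀ ℕ) → ι) :
    MvPolynomial σ K →ₗ[K] ι →₀ K :=
  (basisMonomials σ K).constr K fun u => Finsupp.single (c u) 1

variable {K : Type*} [Field K] {σ ι : Type*} (c : (σ →₀ ℕ) → ι)

theorem monomialClassMap_monomial (u : σ →₀ ℕ) (a : K) :
    monomialClassMap K c (monomial u a) = Finsupp.single (c u) a := by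
  have h : monomial u a = a • basisMonomials σ K u := by simp [smul_monomial]
  rw [h, map_smul, monomialClassMap, Module.Basis.constr_basis]
  simp

/-- If monomials of the same class are congruent modulo `I`, and the multiples of the generators of
`I` by monomials vanish under the class map, then the monomials are congruent modulo `I` exactly when
their classes agree, and the class map induces an embedding of `S / I`. -/
theorem ker_monomialClassMap (I : Ideal (MvPolynomial σ K))
    (hI : ∀ u v, c u = c v → (monomial u 1 - monomial v 1 : MvPolynomial σ K) ∈ I)
    (S : Set (MvPolynomial σ K)) (hS : I = Ideal.span S)
    (hSc : ∀ p ∈ S, ∀ w, monomialClassMap K c (monomial w 1 * p) = 0) :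
    LinearMap.ker (Ideal.Quotient.mkₐ K I).toLinearMap = LinearMap.ker (monomialClassMap K c) := by
  apply le_antisymm
  · have key : ∀ p ∈ Ideal.span S, ∀ a, monomialClassMap K c (a * p) = 0 := by
      intro p hp
      refine Submodule.span_induction ?_ ?_ ?_ ?_ hp
      · intro p hp a
        induction a using MvPolynomial.induction_on' with
        | monomial w b =>
          have : (monomial w b : MvPolynomial σ K) = b • monomial w 1 := by simp [smul_monomial]
          rw [this, smul_mul_assoc, map_smul, hSc p hp, smul_zero]
        | add p q hp hq => rw [add_mul, map_add, hp, hq, add_zero]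
      · simp
      · intro p q _ _ hp hq a
        rw [mul_add, map_add, hp, hq, add_zero]
      · intro b p _ hp a
        rw [smul_eq_mul, ← mul_assoc, hp]
    intro p hp
    have hp : p ∈ I := by
      simpa [Ideal.Quotient.eq_zero_iff_mem] using hp
    rw [LinearMap.mem_ker, ← one_mul p]
    exact key p (hS ▸ hp) 1
  · -- a linear section on classes recovers the quotient map from the class map
    let Ψ : (ι →₀ K) →ₗ[K] MvPolynomial σ K ⧸ I :=
      Finsupp.linearCombination K fun i =>
        Ideal.Quotient.mkₐ K I (monomial (Function.invFun c i) 1)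
    have hΨ : Ψ ∘ₗ monomialClassMap K c = (Ideal.Quotient.mkₐ K I).toLinearMap := by
      refine (basisMonomials σ K).ext fun u => ?_
      have hu : c (Function.invFun c (c u)) = c u := Function.invFun_eq ⟨u, rfl⟩
      simp only [coe_basisMonomials, LinearMap.comp_apply, monomialClassMap_monomial, Ψ,
        Finsupp.linearCombination_single, one_smul]
      exact Ideal.Quotient.eq.mpr (hI _ _ hu)
    intro p hp
    rw [LinearMap.mem_ker] at hp ⊢
    rw [← hΨ, LinearMap.comp_apply, hp, map_zero]

theorem homogeneousSubmodule_eq_span_monomial (d : ℕ) :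
    homogeneousSubmodule σ K d =
      Submodule.span K ((fun u => monomial u (1 : K)) '' {u : σ →₀ ℕ | u.degree = d}) := by
  apply le_antisymm
  · intro p hp
    rw [p.as_sum]
    refine Submodule.sum_mem _ fun u hu => ?_
    have : (monomial u (p.coeff u) : MvPolynomial σ K) = p.coeff u • monomial u 1 := by
      simp [smul_monomial]
    rw [this]
    refine Submodule.smul_mem _ _ (Submodule.subset_span ⟨u, ?_, rfl⟩)
    by_contra hne
    exact (mem_support_iff.mp hu)
      (((mem_homogeneousSubmodule d p).mp hp).coeff_eq_zero hne)
  · rw [Submodule.span_le]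
    rintro _ ⟨u, hu, rfl⟩
    exact isHomogeneous_monomial 1 hu

theorem finrank_map_monomialClassMap [DecidableEq ι] (d : ℕ) (D : Finset (σ →₀ ℕ))
    (hD : ∀ u, u ∈ D ↔ u.degree = d) :
    Module.finrank K ((homogeneousSubmodule σ K d).map (monomialClassMap K c)) =
      (D.image c).card := by
  have h : (homogeneousSubmodule σ K d).map (monomialClassMap K c) =
      Finsupp.supported K K ((D.image c : Finset ι) : Set ι) := by
    rw [homogeneousSubmodule_eq_span_monomial, Submodule.map_span, Finsupp.supported_eq_span_single,
      Set.image_image]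
    simp only [monomialClassMap_monomial]
    have : {u : σ →₀ ℕ | u.degree = d} = D := by ext u; simp [hD]
    rw [this, Finset.coe_image, Set.image_image]
  rw [h, (Finsupp.supportedEquivFinsupp _).finrank_eq, Module.finrank_finsupp_self]
  simp

end LinearAlgebra

/-! ### Congruence of monomials modulo the generalized binomial edge ideal -/

section Swaps

open MvPolynomial

variable {K : Type*} [Field K] {m n r : ℕ} {G : SimpleGraph (Fin n)} {V : Fin r → Finset (Fin n)}

/-- The order of the rows and of the columns in a generator does not matter, and the rows may even
coincide. -/
theorem minor_mem_generalizedBinomialEdgeIdeal {k l : Fin n} (h : G.Adj k l) (i j : Fin m) :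
    (X (i, k) * X (j, l) - X (i, l) * X (j, k) : MvPolynomial (Fin m × Fin n) K) ∈
      generalizedBinomialEdgeIdeal K m G := by
  have key : ∀ {i j k l}, i < j → k < l → G.Adj k l →
      (X (i, k) * X (j, l) - X (i, l) * X (j, k) : MvPolynomial (Fin m × Fin n) K) ∈
        generalizedBinomialEdgeIdeal K m G := fun {i j k l} hij hkl hG =>
    Ideal.subset_span ⟨i, j, k, l, hij.ne, hij, hG, hkl, rfl⟩
  rcases lt_trichotomy i j with hij | rfl | hij
  · rcases h.ne.lt_or_gt with hkl | hkl
    · exact key hij hkl h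
    · have := neg_mem (key hij hkl h.symm)
      convert this using 1
      ring
  · convert Ideal.zero_mem _ using 1
    ring
  · rcases h.ne.lt_or_gt with hkl | hkl
    · have := neg_mem (key hij hkl h)
      convert this using 1
      ring
    · have := key hij hkl h.symm
      convert this using 1
      ring

/-- Exchanging the rows of two factors of a monomial whose columns are adjacent is a move by one
generator. -/
theorem prod_X_swap_sub_mem {d : ℕ} (col : Fin d → Fin n) (ρ : Fin d → Fin m) {s t : Fin d}
    (h : G.Adj (col s) (col t)) :
    (∏ x, X (ρ (Equiv.swap s t x), col x) - ∏ x, X (ρ x, col x) :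
      MvPolynomial (Fin m × Fin n) K) ∈ generalizedBinomialEdgeIdeal K m G := by
  have hst : s ≠ t := by
    rintro rfl
    exact h.ne rfl
  have split (f : Fin d → MvPolynomial (Fin m × Fin n) K) :
      ∏ x, f x = f s * f t * ∏ x ∈ (Finset.univ.erase s).erase t, f x := by
    rw [mul_assoc, Finset.mul_prod_erase _ f (by simp [hst.symm]),
      Finset.mul_prod_erase _ f (Finset.mem_univ s)]
  have hrest : ∏ x ∈ (Finset.univ.erase s).erase t, (X (ρ (Equiv.swap s t x), col x) :
      MvPolynomial (Fin m × Fin n) K) = ∏ x ∈ (Finset.univ.erase s).erase t, X (ρ x, col x) := by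
    refine Finset.prod_congr rfl fun x hx => ?_
    simp only [Finset.mem_erase, Finset.mem_univ, and_true] at hx
    rw [Equiv.swap_apply_of_ne_of_ne hx.2 hx.1]
  rw [split, split, hrest, ← sub_mul, Equiv.swap_apply_left, Equiv.swap_apply_right]
  refine Ideal.mul_mem_right _ _ ?_
  have := minor_mem_generalizedBinomialEdgeIdeal (K := K) h (ρ t) (ρ s)
  convert this using 1
  ring

/-- If two parts occur among the columns of a monomial, its row word may be permuted arbitrarily
modulo the ideal. -/
theorem prod_X_perm_sub_mem (hG : IsCompletePartite G V) {d : ℕ} (col : Fin d → Fin n)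
    (hcol : ∃ s t, G.Adj (col s) (col t)) (σ : Equiv.Perm (Fin d)) (ρ : Fin d → Fin m) :
    (∏ x, X (ρ (σ x), col x) - ∏ x, X (ρ x, col x) :
      MvPolynomial (Fin m × Fin n) K) ∈ generalizedBinomialEdgeIdeal K m G := by
  -- `Good σ`: permuting any row word by `σ` does not change the monomial modulo the ideal
  let Good (σ : Equiv.Perm (Fin d)) : Prop := ∀ ρ : Fin d → Fin m,
    (∏ x, X (ρ (σ x), col x) - ∏ x, X (ρ x, col x) :
      MvPolynomial (Fin m × Fin n) K) ∈ generalizedBinomialEdgeIdeal K m G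
  have one : Good 1 := fun ρ => by simp
  have mul {σ τ} (hσ : Good σ) (hτ : Good τ) : Good (σ * τ) := fun ρ => by
    have := add_mem (hτ (ρ ∘ σ)) (hσ ρ)
    simpa using this
  have cross {s t} (h : G.Adj (col s) (col t)) : Good (Equiv.swap s t) := fun ρ =>
    prod_X_swap_sub_mem col ρ h
  -- nonadjacency is an equivalence relation, so nonadjacent columns have the same neighbours
  have nonadj {s t w} (hst : ¬ G.Adj (col s) (col t)) (hsw : G.Adj (col s) (col w)) :
      G.Adj (col t) (col w) := by
    obtain ⟨i, j, hij, hs, hw⟩ := (hG.adj_iff _ _).mp hsw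
    obtain ⟨i', ht⟩ := hG.cover (col t)
    have : i' = i := by
      by_contra hne
      exact hst ((hG.adj_iff _ _).mpr ⟨i, i', fun h => hne h.symm, hs, ht⟩)
    subst this
    exact (hG.adj_iff _ _).mpr ⟨i', j, hij, ht, hw⟩
  have swap (s t : Fin d) (hst : s ≠ t) : Good (Equiv.swap s t) := by
    by_cases hadj : G.Adj (col s) (col t)
    · exact cross hadj
    · -- route the transposition through a position whose column lies in another part
      obtain ⟨w, hw⟩ : ∃ w, G.Adj (col s) (col w) := by
        obtain ⟨a, b, hab⟩ := hcol
        by_cases hsa : G.Adj (col s) (col a)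
        · exact ⟨a, hsa⟩
        · refine ⟨b, nonadj (s := a) (fun h => hsa h.symm) hab⟩
      have hw' := nonadj hadj hw
      have hwt : w ≠ t := fun h => hw'.ne (by rw [h])
      have hws : w ≠ s := fun h => hw.ne (by rw [h])
      have : Equiv.swap s t = Equiv.swap s w * Equiv.swap t w * Equiv.swap s w := by
        rw [Equiv.swap_comm s w, Equiv.swap_mul_swap_mul_swap hwt.symm hst.symm]
      rw [this]
      exact mul (mul (cross hw) (cross hw')) (cross hw)
  have all : Good σ := by
    induction σ using Equiv.Perm.swap_induction_on with
    | one => exact one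
    | swap_mul f x y hxy ih => exact mul (swap x y hxy) ih
  exact all ρ

theorem monomial_sub_monomial_mem (hG : IsCompletePartite G V) (u v : Fin m × Fin n →₀ ℕ)
    (hrow : u.mapDomain Prod.fst = v.mapDomain Prod.fst)
    (hcol : u.mapDomain Prod.snd = v.mapDomain Prod.snd)
    (hadj : ∃ x y, u x ≠ 0 ∧ u y ≠ 0 ∧ G.Adj x.2 y.2) :
    (monomial u 1 - monomial v 1 : MvPolynomial (Fin m × Fin n) K) ∈
      generalizedBinomialEdgeIdeal K m G := by
  classical
  obtain ⟨f, hf⟩ := exists_sum_single_eq u rfl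
  obtain ⟨g, hg⟩ := exists_sum_single_eq (d := u.degree) v (by
    rw [← Finsupp.degree_mapDomain Prod.fst, ← hrow, Finsupp.degree_mapDomain])
  have hmon (f : Fin u.degree → Fin m × Fin n) :
      (monomial (∑ t, Finsupp.single (f t) 1) 1 : MvPolynomial (Fin m × Fin n) K) =
        ∏ t, X (f t) := by
    rw [monomial_sum_one]
    rfl
  obtain ⟨α, hα⟩ := exists_perm_of_sum_single_eq (fun t => (f t).1) (fun t => (g t).1) (by
    rw [← hf, ← hg] at hrow
    simpa [Finsupp.mapDomain_finsetSum, Finsupp.mapDomain_single] using hrow)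
  obtain ⟨β, hβ⟩ := exists_perm_of_sum_single_eq (fun t => (f t).2) (fun t => (g t).2) (by
    rw [← hf, ← hg] at hcol
    simpa [Finsupp.mapDomain_finsetSum, Finsupp.mapDomain_single] using hcol)
  have hmem (x) (hx : u x ≠ 0) : ∃ t, f t = x := by
    by_contra! hne
    apply hx
    rw [← hf]
    simp [hne]
  have hp : ∃ s t, G.Adj ((fun t => (f t).2) s) ((fun t => (f t).2) t) := by
    obtain ⟨x, y, hx, hy, hxy⟩ := hadj
    obtain ⟨s, rfl⟩ := hmem x hx
    obtain ⟨t, rfl⟩ := hmem y hy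
    exact ⟨s, t, hxy⟩
  -- align the column words by `β`; the row words then differ by `α⁻¹ * β`
  have := prod_X_perm_sub_mem (K := K) hG (fun t => (f t).2) hp (α⁻¹ * β) (fun t => (f t).1)
  rw [← neg_mem_iff, neg_sub]
  convert this using 2
  · rw [← hg, hmon, ← Equiv.prod_comp β]
    refine Finset.prod_congr rfl fun t _ => ?_
    congr 1
    refine Prod.ext ?_ (hβ t)
    have := hα (α⁻¹ (β t))
    simpa using this
  · exact (congrArg (monomial · (1 : K)) hf.symm).trans (hmon f)

end Swaps

/-! ### Counting the invariants -/

section Count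

variable {m n r : ℕ}

/-- The complete invariant of a monomial modulo the generalized binomial edge ideal: the row sums and
the column sums of its exponent matrix, together with the monomial itself if its columns lie in a
single part. The monomial `1` counts as one whose columns lie in a single part. -/
noncomputable def partiteClass (V : Fin r → Finset (Fin n)) (u : Fin m × Fin n →₀ ℕ) :
    (Fin m →₀ ℕ) × (Fin n →₀ ℕ) × Option (Fin m × Fin n →₀ ℕ) :=
  open Classical in
  (u.mapDomain Prod.fst, u.mapDomain Prod.snd,
    if ∃ k, (u.mapDomain Prod.snd).support ⊆ V k then some u else none)

theorem mem_support_mapDomain_snd {u : Fin m × Fin n →₀ ℕ} {l : Fin n} :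
    l ∈ (u.mapDomain Prod.snd).support ↔ ∃ x, u x ≠ 0 ∧ x.2 = l := by
  classical
  rw [Finsupp.mapDomain_support_of_subsingletonAddUnits, Finset.mem_image]
  simp

theorem support_mapDomain_snd_subset_iff {u : Fin m × Fin n →₀ ℕ} {s : Finset (Fin n)} :
    (u.mapDomain Prod.snd).support ⊆ s ↔ u.support ⊆ Finset.univ ×ˢ s := by
  constructor
  · intro h x hx
    simpa using h (mem_support_mapDomain_snd.mpr ⟨x, by simpa using hx, rfl⟩)
  · intro h l hl
    obtain ⟨x, hx, rfl⟩ := mem_support_mapDomain_snd.mp hl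
    simpa using h (Finsupp.mem_support_iff.mpr hx)

theorem mem_finsuppAntidiag_univ {α : Type*} [Fintype α] [DecidableEq α] {d : ℕ} {u : α →₀ ℕ} :
    u ∈ Finset.finsuppAntidiag Finset.univ d ↔ u.degree = d := by
  simp [Finsupp.degree_eq_sum]

theorem mem_finsuppAntidiag_iff_degree {α : Type*} [DecidableEq α] {s : Finset α} {d : ℕ}
    {u : α →₀ ℕ} : u ∈ Finset.finsuppAntidiag s d ↔ u.degree = d ∧ u.support ⊆ s := by
  rw [Finset.mem_finsuppAntidiag]
  refine and_congr_left fun h => ?_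
  rw [Finsupp.degree_apply, Finset.sum_subset h]
  intro x _ hx
  simpa using hx

theorem exists_mapDomain_fst_snd_eq {d : ℕ} {a : Fin m →₀ ℕ} {b : Fin n →₀ ℕ} (ha : a.degree = d)
    (hb : b.degree = d) :
    ∃ u : Fin m × Fin n →₀ ℕ, u.mapDomain Prod.fst = a ∧ u.mapDomain Prod.snd = b := by
  obtain ⟨f, rfl⟩ := exists_sum_single_eq a ha
  obtain ⟨g, rfl⟩ := exists_sum_single_eq b hb
  exact ⟨∑ t, Finsupp.single (f t, g t) 1,
    by simp [Finsupp.mapDomain_finsetSum, Finsupp.mapDomain_single],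
    by simp [Finsupp.mapDomain_finsetSum, Finsupp.mapDomain_single]⟩

theorem card_biUnion_finsuppAntidiag {α : Type*} [DecidableEq α] {W : Fin r → Finset α}
    (hW : Pairwise fun i j => Disjoint (W i) (W j)) {d : ℕ} (hd : 0 < d) :
    (Finset.univ.biUnion fun k => Finset.finsuppAntidiag (W k) d).card =
      ∑ k, (Finset.finsuppAntidiag (W k) d).card := by
  refine Finset.card_biUnion fun i _ j _ hij => Finset.disjoint_left.mpr fun u hi hj => ?_
  rw [mem_finsuppAntidiag_iff_degree] at hi hj
  have hu : u.support = ∅ :=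
    Finset.disjoint_self_iff_empty _ |>.mp ((hW hij).mono hi.2 hj.2)
  rw [Finsupp.support_eq_empty] at hu
  have := hi.1
  rw [hu, map_zero] at this
  omega

open Classical in
/-- In degree `0` the parts do not give disjoint sets of monomials, but then every cardinality is
`1`. -/
theorem card_image_partiteClass (V : Fin r → Finset (Fin n))
    (hV : Pairwise fun i j => Disjoint (V i) (V j)) (d : ℕ) :
    (((Finset.finsuppAntidiag Finset.univ d).image (partiteClass (m := m) V)).card : ℤ) =
      (Finset.finsuppAntidiag (Finset.univ : Finset (Fin m)) d).card *
          (Finset.finsuppAntidiag (Finset.univ : Finset (Fin n)) d).card +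
        ∑ k, (((Finset.finsuppAntidiag ((Finset.univ : Finset (Fin m)) ×ˢ V k) d).card : ℤ) -
          (Finset.finsuppAntidiag (Finset.univ : Finset (Fin m)) d).card *
            (Finset.finsuppAntidiag (V k) d).card) := by
  rcases Nat.eq_zero_or_pos d with rfl | hd
  · simp
  set A := Finset.finsuppAntidiag (Finset.univ : Finset (Fin m)) d
  set B := Finset.finsuppAntidiag (Finset.univ : Finset (Fin n)) d
  set B' := Finset.univ.biUnion fun k => Finset.finsuppAntidiag (V k) d
  set U := Finset.univ.biUnion fun k =>
    Finset.finsuppAntidiag ((Finset.univ : Finset (Fin m)) ×ˢ V k) d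
  have hU {u : Fin m × Fin n →₀ ℕ} :
      u ∈ U ↔ u.degree = d ∧ ∃ k, (u.mapDomain Prod.snd).support ⊆ V k := by
    simp only [U, Finset.mem_biUnion, Finset.mem_univ, true_and, mem_finsuppAntidiag_iff_degree,
      support_mapDomain_snd_subset_iff, exists_and_left]
  have hB' {b : Fin n →₀ ℕ} : b ∈ B' ↔ b.degree = d ∧ ∃ k, b.support ⊆ V k := by
    simp only [B', Finset.mem_biUnion, Finset.mem_univ, true_and, mem_finsuppAntidiag_iff_degree,
      exists_and_left]
  have hBB : B' ⊆ B := fun b hb => mem_finsuppAntidiag_univ.mpr (hB'.mp hb).1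
  have himage : (Finset.finsuppAntidiag Finset.univ d).image (partiteClass (m := m) V) =
      U.image (partiteClass V) ∪ (A ×ˢ (B \ B')).image fun x => (x.1, x.2, none) := by
    ext ⟨a, b, o⟩
    simp only [Finset.mem_image, Finset.mem_union, mem_finsuppAntidiag_univ]
    constructor
    · rintro ⟨u, hu, hc⟩
      by_cases h : ∃ k, (u.mapDomain Prod.snd).support ⊆ V k
      · exact Or.inl ⟨u, hU.mpr ⟨hu, h⟩, hc⟩
      · refine Or.inr ⟨(u.mapDomain Prod.fst, u.mapDomain Prod.snd), ?_, ?_⟩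
        · simp only [Finset.mem_product, Finset.mem_sdiff, A, B, mem_finsuppAntidiag_univ,
            Finsupp.degree_mapDomain, hB', hu]
          exact ⟨trivial, trivial, fun h' => h h'.2⟩
        · rw [← hc]
          simp [partiteClass, h]
    · rintro (⟨u, hu, hc⟩ | ⟨⟨a', b'⟩, hab, hc⟩)
      · exact ⟨u, (hU.mp hu).1, hc⟩
      · simp only [Prod.mk.injEq] at hc
        obtain ⟨rfl, rfl, rfl⟩ := hc
        simp only [Finset.mem_product, Finset.mem_sdiff, A, B, mem_finsuppAntidiag_univ, hB'] at hab
        obtain ⟨ha, hb, hn⟩ := hab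
        obtain ⟨u, rfl, rfl⟩ := exists_mapDomain_fst_snd_eq ha hb
        rw [Finsupp.degree_mapDomain] at ha
        have h : ¬ ∃ k, (u.mapDomain Prod.snd).support ⊆ V k := fun h => hn ⟨hb, h⟩
        exact ⟨u, ha, by simp [partiteClass, h]⟩
  have hsome {u} (hu : u ∈ U) : (partiteClass V u).2.2 = some u := by
    simp only [partiteClass]
    rw [if_pos (hU.mp hu).2]
  have hdisj : Disjoint (U.image (partiteClass V))
      ((A ×ˢ (B \ B')).image fun x => (x.1, x.2, none)) := by
    rw [Finset.disjoint_left]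
    intro x hx hx'
    obtain ⟨u, hu, rfl⟩ := Finset.mem_image.mp hx
    obtain ⟨y, -, hy⟩ := Finset.mem_image.mp hx'
    have := hsome hu
    rw [← hy] at this
    simp at this
  have hcardU : (U.image (partiteClass V)).card = U.card := by
    refine Finset.card_image_of_injOn fun u hu v hv huv => ?_
    have := congrArg (fun x => x.2.2) huv
    simp only [hsome hu, hsome hv] at this
    exact Option.some_injective _ this
  rw [himage, Finset.card_union_of_disjoint hdisj, hcardU, Finset.card_image_of_injective,
    Finset.card_product, Finset.card_sdiff_of_subset hBB]
  · have hUsum : U.card = _ := card_biUnion_finsuppAntidiag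
      (fun i j hij => Finset.disjoint_product.mpr (Or.inr (hV hij))) hd
    have hBsum : B'.card = _ := card_biUnion_finsuppAntidiag hV hd
    push_cast [Finset.card_le_card hBB]
    rw [hUsum, hBsum, Finset.sum_sub_distrib, ← Finset.mul_sum]
    push_cast
    ring
  · rintro ⟨a, b⟩ ⟨a', b'⟩ h
    simpa using h

end Count

/-! ### The Hilbert series -/

open MvPolynomial in
/-- The dimension of a component of the quotient is the number of invariants of the monomials in
that degree. -/
theorem finrank_quotientComponent_generalizedBinomialEdgeIdeal (K : Type*) [Field K] {m n r : ℕ}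
    {G : SimpleGraph (Fin n)} {V : Fin r → Finset (Fin n)} (hG : IsCompletePartite G V) (d : ℕ) :
    Module.finrank K (quotientComponent (generalizedBinomialEdgeIdeal K m G) d) =
      ((Finset.finsuppAntidiag Finset.univ d).image (partiteClass (m := m) V)).card := by
  classical
  rw [quotientComponent, finrank_map_eq_of_ker_eq _ (monomialClassMap K (partiteClass V))]
  · convert finrank_map_monomialClassMap _ d _ fun u => mem_finsuppAntidiag_univ
  refine ker_monomialClassMap _ _ ?_ _ rfl ?_
  · intro u v huv
    have h := huv
    simp only [partiteClass, Prod.mk.injEq] at h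
    obtain ⟨hrow, hcol, ho⟩ := h
    by_cases hs : ∃ k, (u.mapDomain Prod.snd).support ⊆ V k
    · rw [if_pos hs, if_pos (hcol ▸ hs)] at ho
      rw [Option.some_injective _ ho, sub_self]
      exact zero_mem _
    -- `u = 0` is possible here only if there are no parts at all
    · rcases eq_or_ne u 0 with rfl | hu
      · have hv := congrArg Finsupp.degree hrow
        rw [Finsupp.degree_mapDomain, Finsupp.degree_mapDomain, map_zero, eq_comm,
          Finsupp.degree_eq_zero_iff] at hv
        rw [hv, sub_self]
        exact zero_mem _
      refine monomial_sub_monomial_mem hG u v hrow hcol ?_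
      by_contra! hna
      apply hs
      obtain ⟨x, hx⟩ := Finsupp.ne_iff.mp hu
      obtain ⟨k, hk⟩ := hG.cover x.2
      refine ⟨k, fun l hl => ?_⟩
      obtain ⟨y, hy, rfl⟩ := mem_support_mapDomain_snd.mp hl
      obtain ⟨k', hk'⟩ := hG.cover y.2
      by_cases hkk : k = k'
      · exact hkk ▸ hk'
      · exact absurd ((hG.adj_iff _ _).mpr ⟨k, k', hkk, hk, hk'⟩) (hna x y hx hy)
  · rintro _ ⟨i, j, k, l, -, -, hadj, -, rfl⟩ w
    have hnot (u : Fin m × Fin n →₀ ℕ) (hk : k ∈ (u.mapDomain Prod.snd).support)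
        (hl : l ∈ (u.mapDomain Prod.snd).support) :
        ¬ ∃ p, (u.mapDomain Prod.snd).support ⊆ V p := by
      rintro ⟨p, hp⟩
      obtain ⟨a, b, hab, ha, hb⟩ := (hG.adj_iff _ _).mp hadj
      have hap : a = p := by
        by_contra hne
        exact Finset.disjoint_left.mp (hG.disjoint hne) ha (hp hk)
      have hbp : b = p := by
        by_contra hne
        exact Finset.disjoint_left.mp (hG.disjoint hne) hb (hp hl)
      exact hab (hap.trans hbp.symm)
    simp only [X, mul_sub, monomial_mul, mul_one, map_sub, monomialClassMap_monomial]
    rw [sub_eq_zero]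
    congr 1
    have h1 := hnot (w + (Finsupp.single (i, k) 1 + Finsupp.single (j, l) 1))
      (mem_support_mapDomain_snd.mpr ⟨(i, k), by simp, rfl⟩)
      (mem_support_mapDomain_snd.mpr ⟨(j, l), by simp, rfl⟩)
    have h2 := hnot (w + (Finsupp.single (i, l) 1 + Finsupp.single (j, k) 1))
      (mem_support_mapDomain_snd.mpr ⟨(j, k), by simp, rfl⟩)
      (mem_support_mapDomain_snd.mpr ⟨(i, l), by simp, rfl⟩)
    unfold partiteClass
    rw [if_neg h1, if_neg h2]
    simp only [Finsupp.mapDomain_add, Finsupp.mapDomain_single]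
    rw [add_comm (Finsupp.single l 1)]

theorem mainTheorem5 (K : Type*) [Field K] (m n r : ℕ) (hm : 2 ≤ m) (hr : 2 ≤ r)
    (N : Fin r → ℕ) (s : Fin r)
    (hone : ∀ k, k < s → N k = 1) (htwo : ∀ k, s ≤ k → 2 ≤ N k) (hmono : Monotone N)
    (G : SimpleGraph (Fin n)) (V : Fin r → Finset (Fin n)) (hG : IsCompletePartite G V)
    (hcard : ∀ k, (V k).card = N k) :
    hilbertSeries (generalizedBinomialEdgeIdeal K m G) =
      minorSeries m n +
        ∑ k ∈ Finset.Ici s,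
          ((PowerSeries.invOneSubPow ℤ (m * N k) : ℤ⟦X⟧) - minorSeries m (N k)) := by
  have hm0 : 0 < m := by omega
  have hN (k) : 0 < N k := by
    rcases lt_or_ge k s with h | h
    · rw [hone k h]; exact one_pos
    · have := htwo k h; omega
  have hn : 0 < n := by
    have h := (V s).card_le_univ
    rw [hcard, Fintype.card_fin] at h
    exact (hN s).trans_le h
  ext d
  rw [hilbertSeries, PowerSeries.coeff_mk,
    finrank_quotientComponent_generalizedBinomialEdgeIdeal K hG,
    card_image_partiteClass V hG.disjoint,
    map_add, map_sum, coeff_minorSeries hm0 hn]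
  simp only [map_sub, coeff_minorSeries hm0 (hN _), coeff_invOneSubPow (Nat.mul_pos hm0 (hN _)),
    Finset.card_finsuppAntidiag_nat_eq_choose, Finset.card_product, Finset.card_univ,
    Fintype.card_fin, hcard]
  congr 1
  -- a one-vertex part contributes nothing
  refine (Finset.sum_subset (Finset.subset_univ _) fun k _ hk => ?_).symm
  rw [hone k (by simpa using hk)]
  simp
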